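/- A left regular band is a semigroup $S$ with $x^2=x$ and $xyx=xy$ for all $x,y\in S$. It is partially ordered by $y\le x\iff yx=x$. Its support lattice $L$ is the poset obtained from the preorder $y\preceq x\iff xy=x$ by identifying $x$ and $y$ when $x\preceq y\preceq x$; $\operatorname{supp}:S\to L$ is the quotient map, and $S_X=\{x\in S:\operatorname{supp}(x)=X\}$ for $X\in L$. For $Y\le X$ in $L$ fix $y\in S$ with $\operatorname{supp}(y)=Y$ and, for $x,x'\in S_X$, write $x\smile x'$ if $yx=yx'$ or there is $w\in S$ with $y<w$, $w<yx$ and $w<yx'$. Let $\sim$ be the equivalence relation on $S_X$ generated by $\smile$, and put $a^S_{XY}=\#(S_X/{\sim})-1\in\mathbb N\cup\{\infty\}$ (this does not depend on the choice of $y$). If $Y\not\le X$, put $a^S_{XY}=0$. For a finite-dimensional algebra $A$ over a field $k$ whose simple (left) modules are all one-dimensional, the quiver of $A$ has one vertex for each isomorphism class of simple $A$-modules and $\dim_k\operatorname{Ext}^1_A(M,N)$ arrows from the class of $M$ to the class of $N$. If $S$ is a finite left regular band with identity and $X\in L$, let $M_X$ be the vector space $k$ on which $s\in S$ acts as $1$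 if $\operatorname{supp}(s)\le X$ and as $0$ otherwise. **Proposition.** Let $S$ be a left regular band with identity, with support lattice $L$. Let $y\in S$, $X\in L$, $Y=\operatorname{supp}(y)$, and let $yS_{\le X}$ be the subsemigroup of all elements of $yS=\{yw:w\in S\}$ whose support is $\le X$. If $Y\not\le X$, then $yS_{\le X}$ and the interval $[Y,X]$ are empty and $a^S_{XY}=0$. If $Y\le X$, then $yS_{\le X}=\{yw:w\in S,\ \operatorname{supp}(w)\le X\}$ is a left regular band with identity $y$, and $\operatorname{supp}(t)\mapsto\operatorname{supp}(t)$ ($t\in yS_{\le X}$) is an order isomorphism $\iota$ from the support lattice of $yS_{\le X}$ onto the interval $[Y,X]$ of $L$. Moreover: 1. With $\hat 1$ and $\hat 0$ the greatest and least elements of the support lattice of $yS_{\le X}$, $$a^S_{XY}=a^{\,yS_{\le X}}_{\hat1\hat0}.$$ 2. If $S$ is finite and $k$ is any field, then $Z\mapsto[M_Z]$ is a bijection from $L$ to the vertices of the quiver of $kS$, and the quiver of $k(yS_{\le X})$ is the full subquiver of the quiver of $kS$ on the vertices in the interval $[Y,X]$: there is an isomorphism of quivers from the quiver of $k(yS_{\le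 X})$ onto this full subquiver, and it sends the vertex $[M_Z]$ to the vertex $[M_{\iota(Z)}]$ for every $Z$ in the support lattice of $yS_{\le X}$. In particular, the number of arrows from $[M_X]$ to $[M_Y]$ in the quiver of $kS$ is the number of arrows from $[M_{\hat 1}]$ to $[M_{\hat 0}]$ in the quiver of $k(yS_{\le X})$. -/

import Mathlib

open CategoryTheory

universe u v w

/-! ### Left regular bands and their support lattices -/

/-- A left regular band: a semigroup with `x² = x` and `xyx = xy`. -/
class IsLeftRegularBand (S : Type v) [Semigroup S] : Prop where
  mul_self : ∀ x : S, x * x = x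
  mul_mul_self : ∀ x y : S, x * y * x = x * y

namespace LRB

section Order

variable {S : Type v} [Semigroup S]

/-- The strict part of the partial order `y ≤ x ↔ yx = x` on a left regular band. -/
def StrictlyBelow (y x : S) : Prop := y * x = x ∧ y ≠ x

/-- The elements of `S`, preordered by `y ≼ x ↔ xy = x`. -/
def SuppPreorder (S : Type v) : Type v := S

instance [IsLeftRegularBand S] : Preorder (SuppPreorder S) where
  le := fun y x : S => x * y = x
  le_refl := fun x : S => IsLeftRegularBand.mul_self x
  le_trans := fun a b c : S => fun (hab : b * a = b) (hbc : c * b = c) => by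
    rw [← hbc, mul_assoc, hab]

/-- The support lattice `L` of `S`: the poset obtained from the preorder `≼` by identifying
`x` and `y` when `x ≼ y` and `y ≼ x`. -/
abbrev SupportLattice (S : Type v) [Semigroup S] [IsLeftRegularBand S] : Type v :=
  Antisymmetrization (SuppPreorder S) (· ≤ ·)

variable [IsLeftRegularBand S]

/-- The support map `S → L`. -/
def supp (x : S) : SupportLattice S := toAntisymmetrization (α := SuppPreorder S) (· ≤ ·) x

/-- A chosen element of given support. -/
noncomputable def someOfSupp (Y : SupportLattice S) : S :=
  ofAntisymmetrization (α := SuppPreorder S) (· ≤ ·) Y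

theorem supp_someOfSupp (Y : SupportLattice S) : supp (someOfSupp Y) = Y :=
  toAntisymmetrization_ofAntisymmetrization (α := SuppPreorder S) (· ≤ ·) Y

theorem supp_le_supp {x y : S} : supp y ≤ supp x ↔ x * y = x :=
  toAntisymmetrization_le_toAntisymmetrization_iff (α := SuppPreorder S)

theorem supp_mul_le {x y : S} {X : SupportLattice S} :
    supp (x * y) ≤ X ↔ supp x ≤ X ∧ supp y ≤ X := by
  induction X using Antisymmetrization.ind with
  | _ z' =>
    let z : S := z'
    change supp (x * y) ≤ supp z ↔ supp x ≤ supp z ∧ supp y ≤ supp z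
    simp only [supp_le_supp]
    constructor
    · intro h
      have hx : (z * x : S) = z := by
        have h1 : (z * (x * y) * x : S) = z * (x * y) := by
          rw [mul_assoc, IsLeftRegularBand.mul_mul_self]
        rwa [h] at h1
      refine ⟨hx, ?_⟩
      rwa [← mul_assoc, hx] at h
    · rintro ⟨hx, hy⟩
      rw [← mul_assoc, hx, hy]

end Order

/-! ### The numbers `a_{XY}` -/

section ArrowCount

variable {S : Type v} [Semigroup S] [IsLeftRegularBand S]

/-- The set `S_X` of elements of support `X`. -/
abbrev Fiber (X : SupportLattice S) : Type v := {x : S // supp x = X}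

/-- The relation `⌣` on `S_X` attached to `y`: there is `w` with `y < w`, `w < yx`, `w < yx'`.
The second alternative makes `⌣` reflexive and unchanged when `x` is replaced by `yx`; without
it, this fails when nothing lies strictly between `y` and `yx`. -/
def Smile (y : S) {X : SupportLattice S} (x x' : Fiber X) : Prop :=
  (∃ w : S, StrictlyBelow y w ∧ StrictlyBelow w (y * x.1) ∧ StrictlyBelow w (y * x'.1)) ∨
    y * x.1 = y * x'.1

open Classical in
/-- `a_{XY} = #(S_X / ∼) - 1` if `Y ≤ X` and `0` otherwise, where `∼` is the equivalence relation
generated by the relation `⌣` attached to some fixed `y` of support `Y`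
(`Quot` is the quotient by the generated equivalence relation). -/
noncomputable def arrowCount (X Y : SupportLattice S) : ℕ∞ :=
  if Y ≤ X then
    ENat.card (Quot (Smile (someOfSupp Y) (X := X))) - 1
  else 0

end ArrowCount

/-! ### The bands `yS_{≤X}` -/

section Interval

variable {S : Type v} [Monoid S] [IsLeftRegularBand S]

/-- The subsemigroup `yS_{≤X}` of elements of `yS = {yw : w ∈ S}` whose support is `≤ X`. -/
def lowerCoset (y : S) (X : SupportLattice S) : Subsemigroup S where
  carrier := {s | (∃ w, s = y * w) ∧ supp s ≤ X}
  mul_mem' := by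
    rintro _ b ⟨⟨w, rfl⟩, ha⟩ ⟨-, hb⟩
    exact ⟨⟨w * b, mul_assoc y w b⟩, supp_mul_le.2 ⟨ha, hb⟩⟩

/-- If `supp y ≤ X`, then `yS_{≤X}` consists of the products `yw` with `w ∈ S_{≤X}`. -/
theorem mem_lowerCoset_iff {y : S} {X : SupportLattice S} (h : supp y ≤ X) (s : S) :
    s ∈ lowerCoset y X ↔ ∃ w, supp w ≤ X ∧ s = y * w := by
  constructor
  · rintro ⟨⟨w, rfl⟩, hs⟩
    exact ⟨w, (supp_mul_le.1 hs).2, rfl⟩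
  · rintro ⟨w, hw, rfl⟩
    exact ⟨⟨w, rfl⟩, supp_mul_le.2 ⟨h, hw⟩⟩

/-- For `supp y ≤ X`, the left regular band `yS_{≤X}`, a monoid with identity `y`. -/
def IntervalBand (y : S) (X : SupportLattice S) (_h : supp y ≤ X) : Type v := lowerCoset y X

variable {y : S} {X : SupportLattice S} {h : supp y ≤ X}

/-- The inclusion of `yS_{≤X}` in `S`. -/
def IntervalBand.val (t : IntervalBand y X h) : S := Subtype.val (p := (· ∈ lowerCoset y X)) t

instance : Monoid (IntervalBand y X h) where
  mul s t := ⟨s.val * t.val, (lowerCoset y X).mul_mem s.2 t.2⟩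
  mul_assoc s t r := Subtype.ext (mul_assoc s.val t.val r.val)
  one := ⟨y, ⟨1, (mul_one y).symm⟩, h⟩
  one_mul := by
    rintro ⟨_, ⟨w, rfl⟩, hw⟩
    refine Subtype.ext ?_
    change y * (y * w) = y * w
    rw [← mul_assoc, IsLeftRegularBand.mul_self]
  mul_one := by
    rintro ⟨_, ⟨w, rfl⟩, hw⟩
    exact Subtype.ext (IsLeftRegularBand.mul_mul_self y w)

instance : IsLeftRegularBand (IntervalBand y X h) where
  mul_self s := Subtype.ext (IsLeftRegularBand.mul_self s.val)
  mul_mul_self s t := Subtype.ext (IsLeftRegularBand.mul_mul_self s.val t.val)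

end Interval

end LRB

/-! ### Quivers -/

/-- The full subquiver of `V` on a set `P` of vertices. -/
def FullSubquiver {V : Type u} [Quiver.{v} V] (P : Set V) : Type u := {x : V // x ∈ P}

instance {V : Type u} [Quiver.{v} V] (P : Set V) : Quiver.{v} (FullSubquiver P) where
  Hom a b := a.1 ⟶ b.1

/-- An isomorphism of quivers: a bijection on vertices and bijections on arrows. -/
structure QuiverIso (V : Type*) [Quiver V] (W : Type*) [Quiver W] where
  vertexEquiv : V ≃ W
  arrowEquiv : ∀ a b : V, (a ⟶ b) ≃ (vertexEquiv a ⟶ vertexEquiv b)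

/-- The isomorphism relation on simple (left) `A`-modules. -/
instance simpleModuleSetoid (A : Type w) [Ring A] :
    Setoid {M : ModuleCat.{w} A // IsSimpleModule A M} where
  r M N := Nonempty (M.1 ≅ N.1)
  iseqv := ⟨fun M => ⟨Iso.refl M.1⟩, fun ⟨e⟩ => ⟨e.symm⟩, fun ⟨e⟩ ⟨f⟩ => ⟨e.trans f⟩⟩

/-- The vertices of the (Ext-)quiver of a `k`-algebra `A`: isomorphism classes of simple
`A`-modules. -/
def ExtQuiver (k : Type u) (A : Type w) [Field k] [Ring A] [Algebra k A] : Type (w + 1) :=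
  Quotient (simpleModuleSetoid A)

/-- The vertex of the quiver given by a simple module. -/
def ExtQuiver.mk (k : Type u) {A : Type w} [Field k] [Ring A] [Algebra k A]
    (M : ModuleCat.{w} A) (hM : IsSimpleModule A M) : ExtQuiver k A :=
  Quotient.mk (simpleModuleSetoid A) ⟨M, hM⟩

/-- A module representing a vertex of the quiver. -/
noncomputable def ExtQuiver.rep {k : Type u} {A : Type w} [Field k] [Ring A] [Algebra k A]
    (a : ExtQuiver k A) : ModuleCat.{w} A := (Quotient.out a).1

/-- The arrows from `[M]` to `[N]` are indexed by a `k`-basis of `Ext¹_A(M, N)`, so that there are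
`dim_k Ext¹_A(M, N)` of them. -/
noncomputable instance (k : Type u) (A : Type w) [Field k] [Ring A] [Algebra k A] :
    Quiver.{w} (ExtQuiver k A) where
  Hom a b := Module.Free.ChooseBasisIndex k (Abelian.Ext.{w} a.rep b.rep 1)

/-! ### The simple modules `M_X` of `kS` -/

namespace LRB

variable (k : Type u) [Field k] {S : Type v} [Monoid S] [IsLeftRegularBand S]

open Classical in
/-- The character `χ_X : kS → k`, with `χ_X(y) = 1` if `supp y ≤ X` and `0` otherwise. -/
noncomputable def character (X : SupportLattice S) : MonoidAlgebra k S →ₐ[k] k :=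
  MonoidAlgebra.lift k k S
    { toFun := fun y => if supp y ≤ X then 1 else 0
      map_one' := by
        refine if_pos ?_
        induction X using Antisymmetrization.ind with
        | _ z => exact supp_le_supp.2 (mul_one (M := S) z)
      map_mul' := fun x y => by
        by_cases hx : supp x ≤ X <;> by_cases hy : supp y ≤ X <;> simp [supp_mul_le, hx, hy] }

/-- The simple module `M_X`: the `k`-vector space `k` (lifted to the universe of `kS`), on which
`kS` acts through `χ_X`. -/
noncomputable def simpleModule (X : SupportLattice S) : ModuleCat.{max u v} (MonoidAlgebra k S) :=
  (ModuleCat.restrictScalars (character k X).toRingHom).obj (ModuleCat.of k (ULift.{max u v} k))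

theorem isSimpleModule_simpleModule (X : SupportLattice S) :
    IsSimpleModule (MonoidAlgebra k S) (simpleModule k X) := by
  have hs : Function.Surjective (character k X) := fun c =>
    ⟨algebraMap k _ c, (character k X).commutes c⟩
  have hk : IsSimpleModule k (ULift.{max u v} k) :=
    IsSimpleModule.congr ULift.moduleEquiv
  have hs' : RingHomSurjective (character k X).toRingHom := ⟨hs⟩
  let l : simpleModule k X →ₛₗ[(character k X).toRingHom] ULift.{max u v} k :=
    { toFun := fun m => m
      map_add' := fun _ _ => rfl
      map_smul' := fun _ _ => rfl }
  exact (LinearMap.isSimpleModule_iff_of_bijective l Function.bijective_id).2 hk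

/-- The vertex of the quiver of `kS` corresponding to `X ∈ L`: the isomorphism class of `M_X`. -/
noncomputable def simpleVertex (X : SupportLattice S) : ExtQuiver k (MonoidAlgebra k S) :=
  ExtQuiver.mk k (simpleModule k X) (isSimpleModule_simpleModule k X)

end LRB

/-! Everything about supports in `[supp y, X]` is visible after multiplying by `y` and discarding
elements of support not below `X`. For the numbers `a_{XY}`: a witness `w` of `⌣` satisfies `yw = w`
and has support below `X`, so it already lies in `yS_{≤X}`; and `x ⌣ yx`, so `x ↦ yx` is a bijection
on classes (`smile_fiberMap`, `smileQuotEquiv`).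

For the quivers, over a finite band the simple modules are the one-dimensional `M_X`, and `Ext¹`
between modules with characters `χ` and `ψ` is the space of skew derivations modulo multiples of `ψ
- χ` (`nonempty_ext_linearEquiv`). The map `s ↦ ys` or `0` is an algebra retraction `kS →
k(yS_{≤X})` pulling `χ_Z` back to `χ_{ι(Z)}`. A skew derivation `d` for two such characters factors
through it: both characters are `1` at `y`, which forces `d(y) = 0` and `d(ys) = d(s)`, and both
vanish at any `s` of support not below `X`, which forces `d(s) = d(s²) = 0`. Hence the `Ext¹` spaces
over the two algebras are isomorphic. -/

namespace LRB

/-! ### Independence of `⌣` from the choice of `y` -/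

section Band

variable {S : Type v} [Semigroup S] [IsLeftRegularBand S]

theorem supp_eq_supp {a b : S} : supp a = supp b ↔ a * b = a ∧ b * a = b := by
  rw [le_antisymm_iff, supp_le_supp, supp_le_supp, and_comm]

theorem supp_mul_eq_right {a b : S} (h : supp a ≤ supp b) : supp (a * b) = supp b :=
  le_antisymm (supp_mul_le.2 ⟨h, le_rfl⟩) (supp_mul_le.1 le_rfl).2

theorem exists_supp_eq (X : SupportLattice S) : ∃ x : S, supp x = X :=
  ⟨someOfSupp X, supp_someOfSupp X⟩

/-- Left multiplication by `y'` carries a witness for `y` to one for `y'`; strictness survives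
because `yy' = y` lets `y` undo it. -/
theorem StrictlyBelow.mul_left {y y' w z : S} (hy : supp y = supp y') (hyw : y * w = w)
    (h : StrictlyBelow w (y * z)) : StrictlyBelow (y' * w) (y' * z) := by
  obtain ⟨h1, h2⟩ := supp_eq_supp.1 hy
  -- From `yw = w` follows `wy = ywy = yw = w`, so `w` absorbs the `y` in `w(yz) = yz`.
  have hwz : w * z = y * z := by
    rw [← h.1, ← mul_assoc, ← hyw, IsLeftRegularBand.mul_mul_self, hyw]
  refine ⟨?_, fun he => h.2 ?_⟩
  · rw [← mul_assoc, IsLeftRegularBand.mul_mul_self, mul_assoc, hwz, ← mul_assoc, h2]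
  · rw [← hyw, ← h1, mul_assoc, he, ← mul_assoc, h1]

/-- The relation `⌣` only depends on the support of `y`. -/
theorem Smile.of_supp_eq {y y' : S} (hy : supp y = supp y') {X : SupportLattice S}
    {x x' : Fiber X} (h : Smile y x x') : Smile y' x x' := by
  obtain ⟨h1, h2⟩ := supp_eq_supp.1 hy
  rcases h with ⟨w, hw, hx, hx'⟩ | h
  · refine Or.inl ⟨y' * w, ⟨?_, fun he => hw.2 ?_⟩, hx.mul_left hy hw.1, hx'.mul_left hy hw.1⟩
    · rw [← mul_assoc, IsLeftRegularBand.mul_self]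
    · have h3 : y * y' = y * (y' * w) := by rw [← he]
      rw [← mul_assoc, h1, hw.1] at h3
      exact h3
  · right
    rw [← h2, mul_assoc, h, mul_assoc]

theorem smile_eq_of_supp_eq {y y' : S} (hy : supp y = supp y') (X : SupportLattice S) :
    Smile y (X := X) = Smile y' :=
  funext₂ fun _ _ => propext ⟨fun h => h.of_supp_eq hy, fun h => h.of_supp_eq hy.symm⟩

/-- `a_{XY}` can be computed with any `y` of support `Y`. -/
theorem arrowCount_supp {X : SupportLattice S} {y : S} (h : supp y ≤ X) :
    arrowCount X (supp y) = ENat.card (Quot (Smile y (X := X))) - 1 := by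
  rw [arrowCount, if_pos h, smile_eq_of_supp_eq (supp_someOfSupp (supp y))]

end Band

/-! ### The band `yS_{≤X}`: its supports and its classes for `∼` -/

section Interval

variable {S : Type v} [Monoid S] [IsLeftRegularBand S]

theorem isEmpty_lowerCoset {y : S} {X : SupportLattice S} (h : ¬ supp y ≤ X) :
    IsEmpty (lowerCoset y X) := by
  refine ⟨?_⟩
  rintro ⟨_, ⟨w, rfl⟩, hs⟩
  exact h (supp_mul_le.1 hs).1

variable {y : S} {X : SupportLattice S} {h : supp y ≤ X}

namespace IntervalBand

/-- The element `ys` of `yS_{≤X}` for `s` of support `≤ X`. -/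
def mk (h : supp y ≤ X) (s : S) (hs : supp s ≤ X) : IntervalBand y X h :=
  ⟨y * s, ⟨s, rfl⟩, supp_mul_le.2 ⟨h, hs⟩⟩

@[simp] theorem val_mk (s : S) (hs : supp s ≤ X) : (mk h s hs).val = y * s := rfl

@[simp] theorem val_mul (s t : IntervalBand y X h) : (s * t).val = s.val * t.val := rfl

@[ext] theorem ext {s t : IntervalBand y X h} (hst : s.val = t.val) : s = t := Subtype.ext hst

theorem supp_val_le (t : IntervalBand y X h) : supp t.val ≤ X := t.2.2

theorem mul_val (t : IntervalBand y X h) : y * t.val = t.val :=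
  congrArg val (one_mul t)

theorem le_supp_val (t : IntervalBand y X h) : supp y ≤ supp t.val :=
  supp_le_supp.2 (congrArg val (mul_one t))

theorem supp_le_iff {s t : IntervalBand y X h} : supp s ≤ supp t ↔ supp s.val ≤ supp t.val := by
  rw [supp_le_supp, supp_le_supp, IntervalBand.ext_iff, val_mul]

theorem supp_eq_iff {s t : IntervalBand y X h} : supp s = supp t ↔ supp s.val = supp t.val := by
  rw [le_antisymm_iff, supp_le_iff, supp_le_iff, ← le_antisymm_iff]

theorem exists_supp_val_eq {V : SupportLattice S} (h1 : supp y ≤ V) (h2 : V ≤ X) :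
    ∃ t : IntervalBand y X h, supp t.val = V := by
  obtain ⟨v, rfl⟩ := exists_supp_eq V
  exact ⟨mk h v h2, supp_mul_eq_right h1⟩

end IntervalBand

/-- The support lattice of `yS_{≤X}` is the interval `[supp y, X]`. -/
noncomputable def supportIso (h : supp y ≤ X) :
    SupportLattice (IntervalBand y X h) ≃o Set.Icc (supp y) X :=
  RelIso.ofSurjective
    (OrderEmbedding.ofMapLEIff
      (fun Z => (⟨supp (someOfSupp Z).val, (someOfSupp Z).le_supp_val,
        (someOfSupp Z).supp_val_le⟩ : Set.Icc (supp y) X))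
      fun Z W => by
        refine Subtype.mk_le_mk.trans ?_
        rw [← IntervalBand.supp_le_iff, supp_someOfSupp, supp_someOfSupp])
    (by
      rintro ⟨V, h1, h2⟩
      obtain ⟨t, rfl⟩ := IntervalBand.exists_supp_val_eq (h := h) h1 h2
      exact ⟨supp t, Subtype.ext (IntervalBand.supp_eq_iff.1 (supp_someOfSupp (supp t)))⟩)

theorem supportIso_supp (t : IntervalBand y X h) : (supportIso h (supp t)).1 = supp t.val :=
  IntervalBand.supp_eq_iff.1 (supp_someOfSupp (supp t))

theorem supp_le_supportIso {t : IntervalBand y X h} {Z : SupportLattice (IntervalBand y X h)} :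
    supp t.val ≤ (supportIso h Z).1 ↔ supp t ≤ Z := by
  rw [← supportIso_supp, Subtype.coe_le_coe, OrderIso.le_iff_le]

/-- The greatest element of the support lattice of `yS_{≤X}`. -/
noncomputable def topSupp (h : supp y ≤ X) : SupportLattice (IntervalBand y X h) :=
  (supportIso h).symm ⟨X, h, le_rfl⟩

theorem isTop_topSupp : IsTop (topSupp h) := fun Z =>
  (supportIso h).le_symm_apply.2 (supportIso h Z).2.2

theorem isBot_supp_one : IsBot (supp (1 : IntervalBand y X h)) := fun Z => by
  obtain ⟨t, rfl⟩ := exists_supp_eq Z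
  exact supp_le_supp.2 (mul_one t)

theorem supp_eq_topSupp {t : IntervalBand y X h} : supp t = topSupp h ↔ supp t.val = X := by
  rw [topSupp, ← OrderIso.symm_apply_eq, OrderIso.symm_symm, Subtype.ext_iff, supportIso_supp]

/-- The map `x ↦ yx` from `S_X` to the elements of greatest support in `yS_{≤X}`. -/
def fiberMap (h : supp y ≤ X) (x : Fiber X) : Fiber (topSupp h) :=
  ⟨IntervalBand.mk h x.1 x.2.le, supp_eq_topSupp.2 (by
    rw [IntervalBand.val_mk, supp_mul_eq_right (h.trans x.2.ge), x.2])⟩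

theorem strictlyBelow_iff {s t : IntervalBand y X h} :
    StrictlyBelow s t ↔ StrictlyBelow s.val t.val := by
  simp only [StrictlyBelow, ne_eq, IntervalBand.ext_iff, IntervalBand.val_mul]

/-- No witness is lost in the smaller band: `y < w` puts `w` in `yS`, and `w < yx` bounds its
support by `X`. -/
theorem smile_fiberMap {x x' : Fiber X} :
    Smile (1 : IntervalBand y X h) (fiberMap h x) (fiberMap h x') ↔ Smile y x x' := by
  simp only [Smile, one_mul, strictlyBelow_iff, IntervalBand.ext_iff]
  refine or_congr ⟨?_, ?_⟩ Iff.rfl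
  · rintro ⟨w, hw⟩
    exact ⟨w.val, hw⟩
  · rintro ⟨w, hw, hx, hx'⟩
    have hwX : supp w ≤ X := (supp_mul_le.1
      (hx.1.symm ▸ supp_mul_le.2 ⟨h, x.2.le⟩ : supp (w * (y * x.1)) ≤ X)).1
    have hv : (IntervalBand.mk h w hwX).val = w := hw.1
    refine ⟨IntervalBand.mk h w hwX, ?_⟩
    rw [hv]
    exact ⟨hw, hx, hx'⟩

/-- The classes of `S_X` for `∼` are those of the elements of greatest support of `yS_{≤X}`. -/
noncomputable def smileQuotEquiv (h : supp y ≤ X) :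
    Quot (Smile y (X := X)) ≃ Quot (Smile (1 : IntervalBand y X h) (X := topSupp h)) where
  toFun := Quot.map (fiberMap h) fun _ _ => smile_fiberMap.2
  invFun := Quot.map (fun t => ⟨t.1.val, supp_eq_topSupp.1 t.2⟩) fun a b hab => by
    refine smile_fiberMap (h := h).1 ?_
    convert hab <;> exact Subtype.ext (IntervalBand.ext (IntervalBand.mul_val _))
  left_inv := by
    rintro ⟨x⟩
    -- The round trip replaces `x` by `yx`; the equality alternative of `Smile` identifies their
    -- classes.
    refine Quot.sound (Or.inr ?_)
    change y * (y * x.1) = y * x.1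
    rw [← mul_assoc, IsLeftRegularBand.mul_self]
  right_inv := by
    rintro ⟨t⟩
    exact congrArg (Quot.mk _) (Subtype.ext (IntervalBand.ext (IntervalBand.mul_val _)))

theorem arrowCount_eq_arrowCount_intervalBand (h : supp y ≤ X) :
    arrowCount X (supp y) = arrowCount (topSupp h) (supp (1 : IntervalBand y X h)) := by
  rw [arrowCount_supp h, arrowCount_supp (isTop_topSupp _), ENat.card_congr (smileQuotEquiv h)]

end Interval

end LRB

/-! ### One-dimensional modules and skew derivations -/

section Character

open scoped ModuleCat

variable {k : Type u} [Field k] {A : Type w} [Ring A] [Algebra k A]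

/-- The `A`-module `M` is the one-dimensional space `k` on which `A` acts through `χ`. -/
def HasCharacter (χ : A →ₐ[k] k) (M : ModuleCat.{w} A) : Prop :=
  ∃ e : M ≃+ k, ∀ (a : A) (m : M), e (a • m) = χ a * e m

namespace HasCharacter

variable {χ ψ : A →ₐ[k] k} {M N : ModuleCat.{w} A}

theorem nonempty_iso (hM : HasCharacter χ M) (hN : HasCharacter χ N) : Nonempty (M ≅ N) := by
  obtain ⟨e, he⟩ := hM
  obtain ⟨f, hf⟩ := hN
  refine ⟨LinearEquiv.toModuleIso (X₁ := M) (X₂ := N)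
    { e.trans f.symm with
      map_smul' := fun a m => f.injective ?_ }⟩
  change f (f.symm (e (a • m))) = f (a • f.symm (e m))
  rw [hf, f.apply_symm_apply, f.apply_symm_apply, he]

theorem of_iso (hM : HasCharacter χ M) (i : M ≅ N) : HasCharacter χ N := by
  obtain ⟨e, he⟩ := hM
  refine ⟨i.toLinearEquiv.symm.toAddEquiv.trans e, fun a m => ?_⟩
  change e (i.toLinearEquiv.symm (a • m)) = χ a * e (i.toLinearEquiv.symm m)
  rw [map_smul, he]

/-- The element `a` and the scalar `χ(a)` act alike on the generator `e⁻¹(1)`; reading this through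
`f` gives `ψ(a) = χ(a)`. -/
theorem unique (hχ : HasCharacter χ M) (hψ : HasCharacter ψ M) : χ = ψ := by
  obtain ⟨e, he⟩ := hχ
  obtain ⟨f, hf⟩ := hψ
  ext a
  have h1 : a • e.symm 1 = algebraMap k A (χ a) • e.symm 1 := e.injective (by
    rw [he, he, AlgHom.commutes]; rfl)
  have h2 := congrArg f h1
  rw [hf, hf, AlgHom.commutes] at h2
  have h3 : f (e.symm 1) ≠ 0 := by simp
  exact (mul_right_cancel₀ h3 h2).symm

end HasCharacter

/-- The linear maps `d : A → k` with `d (ab) = ψ(a) d(b) + d(a) χ(b)`. -/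
def skewDerivation (χ ψ : A →ₐ[k] k) : Submodule k (A → k) where
  carrier := {d | IsLinearMap k d ∧ ∀ a b, d (a * b) = ψ a * d b + d a * χ b}
  zero_mem' := ⟨(0 : A →ₗ[k] k).isLinear, fun a b => by simp⟩
  add_mem' := fun {d d'} hd hd' => ⟨(hd.1.mk' d + hd'.1.mk' d').isLinear, fun a b => by
    simp only [Pi.add_apply, hd.2 a b, hd'.2 a b]
    ring⟩
  smul_mem' := fun c d hd => ⟨(c • hd.1.mk' d).isLinear, fun a b => by
    simp only [Pi.smul_apply, hd.2 a b, smul_eq_mul]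
    ring⟩

/-- A skew derivation as a linear map. -/
def skewLinearMap {χ ψ : A →ₐ[k] k} (d : skewDerivation χ ψ) : A →ₗ[k] k :=
  d.2.1.mk' d.1

theorem skewLinearMap_mul {χ ψ : A →ₐ[k] k} (d : skewDerivation χ ψ) (a b : A) :
    skewLinearMap d (a * b) = ψ a * skewLinearMap d b + skewLinearMap d a * χ b :=
  d.2.2 a b

theorem skewLinearMap_one {χ ψ : A →ₐ[k] k} (d : skewDerivation χ ψ) :
    skewLinearMap d 1 = 0 := by
  simpa using skewLinearMap_mul d 1 1

/-- The multiples of `ψ - χ`. -/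
def innerSkewDerivation (χ ψ : A →ₐ[k] k) : Submodule k (A → k) :=
  k ∙ (fun a => ψ a - χ a)

/-- `Ext¹(M, N)` for one-dimensional `M` and `N` is the space of skew derivations modulo the
inner ones. -/
theorem nonempty_ext_linearEquiv {χ ψ : A →ₐ[k] k} {M N : ModuleCat.{w} A}
    (hM : HasCharacter χ M) (hN : HasCharacter ψ N) :
    Nonempty ((skewDerivation χ ψ ⧸ (innerSkewDerivation χ ψ).submoduleOf (skewDerivation χ ψ))
      ≃ₗ[k] Abelian.Ext.{w} M N 1) := by
  obtain ⟨e, he⟩ := hM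
  obtain ⟨f, hf⟩ := hN
  have hfs (a : A) (c : k) : f.symm (ψ a * c) = a • f.symm c :=
    f.injective (by rw [hf, f.apply_symm_apply, f.apply_symm_apply])
  -- The presentation `0 → ker χ → A → M → 0` has `A` projective, so `Ext¹(M, N)` is `Hom(ker χ, N)`
  -- modulo the restrictions of maps `A → N`.
  let π : A →ₗ[A] M := LinearMap.toSpanSingleton A M (e.symm 1)
  have heπ (a : A) : e (π a) = χ a := by
    simp [π, he]
  have hπ : Function.Surjective π := fun m => ⟨algebraMap k A (e m), e.injective (by
    rw [heπ, AlgHom.commutes]; rfl)⟩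
  have hker (x : LinearMap.ker π) : χ x.1 = 0 := by
    rw [← heπ, x.2, map_zero]
  have hmem (a : A) : a - algebraMap k A (χ a) ∈ LinearMap.ker π := by
    rw [LinearMap.mem_ker]
    apply e.injective
    rw [heπ, map_sub, AlgHom.commutes, map_zero]
    exact sub_self _
  have hS := LinearMap.shortExact_shortComplexKer hπ
  -- On `ker χ` the term `d(a) χ(x)` vanishes, so a skew derivation restricts to an `A`-linear map
  -- into `N`.
  let φ : skewDerivation χ ψ →ₗ[k] (ModuleCat.of A (LinearMap.ker π) ⟶ N) :=
    { toFun := fun d => ModuleCat.ofHom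
        { toFun := fun x => f.symm (skewLinearMap d x.1)
          map_add' := fun x x' => by simp
          map_smul' := fun a x => by
            rw [RingHom.id_apply, ← hfs, Submodule.coe_smul, smul_eq_mul, skewLinearMap_mul d, hker x,
              mul_zero, add_zero] }
      map_add' := fun d d' => by
        ext x
        exact map_add f.symm (skewLinearMap d x.1) (d'.1 x.1)
      map_smul' := fun c d => by
        ext x
        change f.symm (c * skewLinearMap d x.1) = algebraMap k A c • f.symm (skewLinearMap d x.1)
        rw [← hfs, AlgHom.commutes]; rfl }
  have hφ (d : skewDerivation χ ψ) (x : LinearMap.ker π) : f (φ d x) = skewLinearMap d x.1 :=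
    f.apply_symm_apply _
  let δ : skewDerivation χ ψ →ₗ[k] Abelian.Ext.{w} M N 1 :=
    (Abelian.Ext.precompOfLinear hS.extClass k N (add_zero 1)) ∘ₗ
      Abelian.Ext.linearEquiv₀.symm.toLinearMap ∘ₗ φ
  have hδ (d) : δ d = hS.extClass.comp (Abelian.Ext.mk₀ (φ d)) (add_zero 1) := rfl
  have hsurj : Function.Surjective δ := by
    intro x
    obtain ⟨x₁, hx₁⟩ := Abelian.Ext.contravariant_sequence_exact₃ hS N x
      (Abelian.Ext.eq_zero_of_projective (P := ModuleCat.of A A) _) (add_zero 1)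
    obtain ⟨g, rfl⟩ := Abelian.Ext.linearEquiv₀ (R := k) |>.symm.surjective x₁
    let g' : LinearMap.ker π →ₗ[A] N := g.hom
    -- Since `A = k ⊕ ker χ` and `d(1) = 0`, the only candidate extending `g` is `d(a) = g(a -
    -- χ(a))`.
    let d : A →ₗ[k] k :=
      { toFun := fun a => f (g' ⟨a - algebraMap k A (χ a), hmem a⟩)
        map_add' := fun a b => by
          rw [← map_add, ← map_add]
          congr 2
          ext
          simp only [map_add, Submodule.coe_add]
          abel
        map_smul' := fun c a => by
          have : f (algebraMap k A c • g' ⟨a - algebraMap k A (χ a), hmem a⟩) =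
              c • f (g' ⟨a - algebraMap k A (χ a), hmem a⟩) := by
            rw [hf, AlgHom.commutes]; rfl
          rw [RingHom.id_apply, ← this, ← map_smul]
          congr 2
          ext
          simp [Algebra.smul_def, mul_sub] }
    -- This rests on `ab - χ(ab) = a(b - χ(b)) + χ(b)(a - χ(a))`.
    have hd : (d : A → k) ∈ skewDerivation χ ψ := ⟨d.isLinear, fun a b => by
      change f (g' _) = ψ a * f (g' _) + f (g' _) * χ b
      have h1 : f (g' ⟨a - algebraMap k A (χ a), hmem a⟩) * χ b =
          f (algebraMap k A (χ b) • g' ⟨a - algebraMap k A (χ a), hmem a⟩) := by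
        rw [hf, AlgHom.commutes, mul_comm]; rfl
      rw [h1, ← hf, ← map_smul, ← map_smul, ← map_add, ← map_add]
      congr 2
      ext
      simp only [map_mul, Submodule.coe_add, Submodule.coe_smul, smul_eq_mul, mul_sub,
        ← Algebra.commutes (χ b)]
      abel⟩
    refine ⟨⟨d, hd⟩, ?_⟩
    rw [hδ, ← hx₁]
    have hg : φ ⟨d, hd⟩ = g := by
      ext x
      apply f.injective
      refine (hφ ⟨d, hd⟩ x).trans ?_
      change f (g' _) = f (g' x)
      congr 2
      ext
      simp [hker x]
    rw [hg]
    rfl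
  -- The class of `d` vanishes iff `φ d` extends to `A → N`. Such a map is `a ↦ cψ(a)`, and `d(1) =
  -- 0` turns agreement on `ker χ` into `d = c(ψ - χ)`.
  have hkerδ : LinearMap.ker δ =
      (innerSkewDerivation χ ψ).submoduleOf (skewDerivation χ ψ) := by
    ext d
    rw [LinearMap.mem_ker, Submodule.submoduleOf, Submodule.mem_comap, innerSkewDerivation,
      Submodule.mem_span_singleton]
    constructor
    · intro h
      rw [hδ] at h
      obtain ⟨x₂, hx₂⟩ := Abelian.Ext.contravariant_sequence_exact₁ hS N _ (add_zero 1) h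
      obtain ⟨g, rfl⟩ := Abelian.Ext.linearEquiv₀ (R := k) |>.symm.surjective x₂
      have hg : (LinearMap.shortComplexKer π).f ≫ g = φ d := by
        apply (Abelian.Ext.linearEquiv₀ (R := k)).symm.injective
        refine Eq.trans ?_ hx₂
        exact (Abelian.Ext.mk₀_comp_mk₀ _ _).symm
      let g' : A →ₗ[A] N := g.hom
      have hgd (x : LinearMap.ker π) : f (g' x.1) = skewLinearMap d x.1 := by
        rw [← hφ, ← hg]
        rfl
      have hg1 (a : A) : f (g' a) = ψ a * f (g' 1) := by
        rw [← hf, ← map_smul, smul_eq_mul, mul_one]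
      refine ⟨f (g' 1), funext fun a => ?_⟩
      have h2 := hgd ⟨a - algebraMap k A (χ a), hmem a⟩
      rw [hg1] at h2
      have h3 : skewLinearMap d (algebraMap k A (χ a)) = 0 := by
        rw [Algebra.algebraMap_eq_smul_one, map_smul, skewLinearMap_one d, smul_zero]
      have h4 : ψ (algebraMap k A (χ a)) = χ a := AlgHom.commutes _ _
      simp only [map_sub, h3, h4, sub_zero] at h2
      change f (g' 1) * (ψ a - χ a) = skewLinearMap d a
      rw [← h2]
      ring
    · rintro ⟨c, hc⟩
      let g : ModuleCat.of A A ⟶ N :=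
        ModuleCat.ofHom (LinearMap.toSpanSingleton A N (f.symm c))
      have hg : (LinearMap.shortComplexKer π).f ≫ g = φ d := by
        ext x
        apply f.injective
        refine Eq.trans ?_ (hφ d x).symm
        have h1 : skewLinearMap d x.1 = c * ψ x.1 := by
          refine (congrFun hc x.1).symm.trans ?_
          simp [hker x]
        rw [h1]
        change f (x.1 • f.symm c) = _
        rw [hf, f.apply_symm_apply, mul_comm]
      rw [hδ, ← hg, ← Abelian.Ext.mk₀_comp_mk₀]
      exact hS.extClass_comp_assoc _
  exact ⟨(Submodule.quotEquivOfEq _ _ hkerδ.symm).trans (δ.quotKerEquivOfSurjective hsurj)⟩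

end Character

/-! ### Skew derivations along a split surjection -/

section Pullback

variable {k : Type u} [Field k] {A : Type v} [Ring A] [Algebra k A] {B : Type w} [Ring B]
  [Algebra k B]

/-- Pulling back along `p : A → B` is bijective on skew derivations modulo inner ones if `p` has a
linear section `j` such that the skew derivations of `A` are determined by their values on `j`. -/
theorem nonempty_skewDerivation_linearEquiv (p : A →ₐ[k] B) (j : B →ₗ[k] A)
    (hpj : ∀ b, p (j b) = b) {χ ψ : B →ₐ[k] k}
    (hd : ∀ d ∈ skewDerivation (χ.comp p) (ψ.comp p), ∀ a, d (j (p a)) = d a) :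
    Nonempty ((skewDerivation χ ψ ⧸ (innerSkewDerivation χ ψ).submoduleOf (skewDerivation χ ψ))
      ≃ₗ[k] (skewDerivation (χ.comp p) (ψ.comp p) ⧸
        (innerSkewDerivation (χ.comp p) (ψ.comp p)).submoduleOf
          (skewDerivation (χ.comp p) (ψ.comp p)))) := by
  let E : skewDerivation χ ψ ≃ₗ[k] skewDerivation (χ.comp p) (ψ.comp p) :=
    { toFun := fun d => ⟨fun a => d.1 (p a), (skewLinearMap d ∘ₗ p.toLinearMap).isLinear,
        fun a b => by simpa using d.2.2 (p a) (p b)⟩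
      map_add' := fun d d' => rfl
      map_smul' := fun c d => rfl
      invFun := fun d => ⟨fun b => d.1 (j b), (skewLinearMap d ∘ₗ j).isLinear, fun a b => by
        have h := d.2.2 (j a) (j b)
        -- The section `j` is not assumed multiplicative, but `j(a)j(b)` and `j(ab)` have the same
        -- image under `p`, so `d` agrees on them.
        rw [← hd d.1 d.2, map_mul, hpj, hpj] at h
        simpa [hpj] using h⟩
      left_inv := fun d => Subtype.ext (funext fun b => congrArg d.1 (hpj b))
      right_inv := fun d => Subtype.ext (funext fun a => hd d.1 d.2 a) }
  refine ⟨Submodule.Quotient.equiv _ _ E ?_⟩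
  ext d
  obtain ⟨d, rfl⟩ := E.surjective d
  rw [Submodule.mem_map_equiv, LinearEquiv.symm_apply_apply]
  simp only [Submodule.submoduleOf, Submodule.mem_comap, innerSkewDerivation,
    Submodule.mem_span_singleton, Submodule.subtype_apply]
  refine exists_congr fun c => ⟨fun h => funext fun a => ?_, fun h => funext fun b => ?_⟩
  · exact congrFun h (p a)
  · rw [← hpj b]
    exact congrFun h (j b)

end Pullback

namespace LRB

/-! ### Classification of the simple `kS`-modules -/

section Simple

variable (k : Type u) [Field k] {S : Type v} [Monoid S] [IsLeftRegularBand S]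

open Classical in
theorem character_of (X : SupportLattice S) (s : S) :
    character k X (MonoidAlgebra.of k S s) = if supp s ≤ X then 1 else 0 :=
  MonoidAlgebra.lift_of _ _

theorem character_injective :
    Function.Injective (character k : SupportLattice S → MonoidAlgebra k S →ₐ[k] k) := by
  have key (X Z : SupportLattice S) (h : character k X = character k Z) : X ≤ Z := by
    obtain ⟨x, rfl⟩ := exists_supp_eq X
    have h1 := DFunLike.congr_fun h (MonoidAlgebra.of k S x)
    by_contra hn
    rw [character_of, character_of, if_pos le_rfl, if_neg hn] at h1
    exact one_ne_zero h1
  exact fun X Z h => le_antisymm (key X Z h) (key Z X h.symm)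

theorem hasCharacter_simpleModule (X : SupportLattice S) :
    HasCharacter (character k X) (simpleModule k X) :=
  ⟨AddEquiv.ulift, fun _ _ => rfl⟩

/-- Every simple `kS`-module is some `M_X`. -/
theorem exists_hasCharacter_of_isSimpleModule [Finite S]
    (M : ModuleCat.{max u v} (MonoidAlgebra k S)) (hM : IsSimpleModule (MonoidAlgebra k S) M) :
    ∃ X : SupportLattice S, HasCharacter (character k X) M := by
  have : Nontrivial M := IsSimpleModule.nontrivial (MonoidAlgebra k S) M
  have : Finite (SupportLattice S) :=
    Finite.of_surjective supp fun X => exists_supp_eq X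
  -- The support sought is a maximal one among those of elements not annihilating `M`.
  let P : Set (SupportLattice S) :=
    {Z | ∃ s : S, supp s = Z ∧ ∃ m : M, MonoidAlgebra.of k S s • m ≠ 0}
  have hP : P.Nonempty := by
    obtain ⟨m, hm⟩ := exists_ne (0 : M)
    exact ⟨supp 1, 1, rfl, m, by rwa [map_one, one_smul]⟩
  obtain ⟨X, ⟨s, rfl, m₀, hm₀⟩, hmax⟩ := P.toFinite.exists_maximal hP
  refine ⟨supp s, ?_⟩
  -- If `supp t ≤ supp s` then `st = s`; otherwise `st` has strictly larger support and kills `M` by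
  -- maximality.
  have hst (t : S) (m : M) : MonoidAlgebra.of k S s • MonoidAlgebra.of k S t • m =
      algebraMap k (MonoidAlgebra k S) (character k (supp s) (MonoidAlgebra.of k S t)) •
        MonoidAlgebra.of k S s • m := by
    rw [character_of, ← mul_smul, ← map_mul]
    split_ifs with ht
    · rw [supp_le_supp.1 ht, map_one, one_smul]
    · rw [map_zero, zero_smul]
      by_contra hne
      exact ht ((supp_mul_le.1 (hmax ⟨s * t, rfl, m, hne⟩ (supp_mul_le.1 le_rfl).1)).2)
  have hsa (a : MonoidAlgebra k S) (m : M) : MonoidAlgebra.of k S s • a • m =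
      algebraMap k (MonoidAlgebra k S) (character k (supp s) a) •
        MonoidAlgebra.of k S s • m := by
    induction a using MonoidAlgebra.induction_on with
    | of t => exact hst t m
    | add a b ha hb => rw [add_smul, smul_add, ha, hb, map_add, map_add, add_smul]
    | smul c a ha =>
      rw [Algebra.smul_def, mul_smul, ← mul_smul (MonoidAlgebra.of k S s), ← Algebra.commutes,
        mul_smul, ha, map_mul, map_mul, mul_smul, AlgHom.commutes]
      rfl
  -- The kernel of `s` is a proper submodule, hence zero; an injective idempotent is the identity,
  -- so the algebra acts on `M` by scalars.
  let K : Submodule (MonoidAlgebra k S) M :=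
    { carrier := {m | MonoidAlgebra.of k S s • m = 0}
      zero_mem' := smul_zero _
      add_mem' := fun {a b} (ha : _ = 0) (hb : _ = 0) => by
        rw [Set.mem_ofPred_eq, smul_add, ha, hb, add_zero]
      smul_mem' := fun c m (hm : _ = 0) => by
        rw [Set.mem_ofPred_eq, hsa, hm, smul_zero] }
  have hK : K = ⊥ := (eq_bot_or_eq_top K).resolve_right fun h =>
    hm₀ (h.symm ▸ Submodule.mem_top : m₀ ∈ K)
  have hs1 (m : M) : MonoidAlgebra.of k S s • m = m := by
    have h1 : MonoidAlgebra.of k S s • m - m ∈ K := by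
      change MonoidAlgebra.of k S s • (MonoidAlgebra.of k S s • m - m) = 0
      rw [smul_sub, ← mul_smul, ← map_mul, IsLeftRegularBand.mul_self, sub_self]
    rw [hK, Submodule.mem_bot] at h1
    exact sub_eq_zero.1 h1
  have hact (a : MonoidAlgebra k S) (m : M) :
      a • m = algebraMap k (MonoidAlgebra k S) (character k (supp s) a) • m := by
    rw [← hs1 (a • m), hsa, hs1]
  obtain ⟨m, hm⟩ := exists_ne (0 : M)
  let g : k →+ M :=
    { toFun := fun c => algebraMap k (MonoidAlgebra k S) c • m
      map_zero' := by rw [map_zero, zero_smul]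
      map_add' := fun c c' => by rw [map_add, add_smul] }
  have hg : Function.Bijective g := by
    constructor
    · refine (injective_iff_map_eq_zero g).2 fun c hc => ?_
      by_contra hne
      refine hm ?_
      rw [← one_smul (MonoidAlgebra k S) m, ← map_one (algebraMap k (MonoidAlgebra k S)),
        ← inv_mul_cancel₀ hne, map_mul, mul_smul]
      exact (congrArg _ hc).trans (smul_zero _)
    · intro n
      obtain ⟨a, rfl⟩ := IsSimpleModule.toSpanSingleton_surjective (MonoidAlgebra k S) hm n
      exact ⟨character k (supp s) a, (hact a m).symm⟩
  refine ⟨(AddEquiv.ofBijective g hg).symm, fun a n => ?_⟩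
  obtain ⟨c, rfl⟩ := (AddEquiv.ofBijective g hg).surjective n
  rw [AddEquiv.symm_apply_apply, AddEquiv.symm_apply_eq, hact]
  change _ • algebraMap k (MonoidAlgebra k S) c • m =
    algebraMap k (MonoidAlgebra k S) (_ * c) • m
  rw [map_mul, mul_smul]

/-- Arrows are defined through arbitrarily chosen representatives, which are only isomorphic to
`M_X`. -/
theorem hasCharacter_rep (X : SupportLattice S) :
    HasCharacter (character k X) (simpleVertex k X).rep := by
  obtain ⟨i⟩ := Quotient.mk_out (s := simpleModuleSetoid (MonoidAlgebra k S))
    ⟨simpleModule k X, isSimpleModule_simpleModule k X⟩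
  exact (hasCharacter_simpleModule k X).of_iso i.symm

theorem simpleVertex_injective :
    Function.Injective
      (simpleVertex k : SupportLattice S → ExtQuiver k (MonoidAlgebra k S)) := fun X Z h =>
  character_injective k ((hasCharacter_rep k X).unique (h ▸ hasCharacter_rep k Z))

theorem simpleVertex_bijective [Finite S] :
    Function.Bijective
      (simpleVertex k : SupportLattice S → ExtQuiver k (MonoidAlgebra k S)) := by
  refine ⟨simpleVertex_injective k, fun a => ?_⟩
  induction a using Quotient.ind with
  | _ M =>
    obtain ⟨X, hX⟩ := exists_hasCharacter_of_isSimpleModule k M.1 M.2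
    exact ⟨X, Quotient.sound ((hasCharacter_simpleModule k X).nonempty_iso hX)⟩

end Simple

/-! ### The retraction `kS → k(yS_{≤X})` and the comparison of quivers -/

section Retraction

variable (k : Type u) [Field k] {S : Type v} [Monoid S] [IsLeftRegularBand S] {y : S}
  {X : SupportLattice S} (h : supp y ≤ X)

open Classical in
/-- The algebra homomorphism `kS → k(yS_{≤X})` with `s ↦ ys` if `supp s ≤ X` and `s ↦ 0`
otherwise. -/
noncomputable def intervalRetraction :
    MonoidAlgebra k S →ₐ[k] MonoidAlgebra k (IntervalBand y X h) :=
  MonoidAlgebra.lift k _ S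
    { toFun := fun s =>
        if hs : supp s ≤ X then MonoidAlgebra.of k _ (IntervalBand.mk h s hs) else 0
      map_one' := by
        have h1 : supp (1 : S) ≤ X := (supp_le_supp.2 (mul_one y)).trans h
        rw [dif_pos h1, ← map_one (MonoidAlgebra.of k _)]
        exact congrArg _ (IntervalBand.ext (mul_one y))
      map_mul' := fun s t => by
        by_cases hs : supp s ≤ X
        · by_cases ht : supp t ≤ X
          · rw [dif_pos (supp_mul_le.2 ⟨hs, ht⟩), dif_pos hs, dif_pos ht, ← map_mul]
            refine congrArg _ (IntervalBand.ext ?_)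
            change y * (s * t) = y * s * (y * t)
            rw [← mul_assoc, ← mul_assoc, IsLeftRegularBand.mul_mul_self]
          · rw [dif_neg fun hst => ht (supp_mul_le.1 hst).2, dif_neg ht, mul_zero]
        · rw [dif_neg fun hst => hs (supp_mul_le.1 hst).1, dif_neg hs, zero_mul] }

theorem intervalRetraction_of_pos {s : S} (hs : supp s ≤ X) :
    intervalRetraction k h (MonoidAlgebra.of k S s) =
      MonoidAlgebra.of k _ (IntervalBand.mk h s hs) :=
  (MonoidAlgebra.lift_of _ _).trans (dif_pos hs)

theorem intervalRetraction_of_neg {s : S} (hs : ¬ supp s ≤ X) :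
    intervalRetraction k h (MonoidAlgebra.of k S s) = 0 :=
  (MonoidAlgebra.lift_of _ _).trans (dif_neg hs)

/-- The linear inclusion of `k(yS_{≤X})` in `kS`. -/
noncomputable def intervalInclusion :
    MonoidAlgebra k (IntervalBand y X h) →ₗ[k] MonoidAlgebra k S :=
  MonoidAlgebra.mapDomainLinearMap k k IntervalBand.val

theorem intervalInclusion_of (t : IntervalBand y X h) :
    intervalInclusion k h (MonoidAlgebra.of k _ t) = MonoidAlgebra.of k S t.val :=
  MonoidAlgebra.mapDomainLinearMap_single _ _ _

theorem intervalRetraction_intervalInclusion (b : MonoidAlgebra k (IntervalBand y X h)) :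
    intervalRetraction k h (intervalInclusion k h b) = b := by
  induction b using MonoidAlgebra.induction_on with
  | of t =>
    rw [intervalInclusion_of, intervalRetraction_of_pos k h t.supp_val_le]
    exact congrArg _ (IntervalBand.ext t.mul_val)
  | add a b ha hb => rw [map_add, map_add, ha, hb]
  | smul c a ha => rw [map_smul, map_smul, ha]

/-- For `V` in `[supp y, X]`, `supp (ys) ≤ V` iff `supp s ≤ V`, and elements sent to `0` are already
killed by `χ_V`. -/
theorem character_comp_intervalRetraction (Z : SupportLattice (IntervalBand y X h)) :
    (character k Z).comp (intervalRetraction k h) = character k (supportIso h Z).1 := by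
  refine AlgHom.ext fun a => ?_
  induction a using MonoidAlgebra.induction_on with
  | of s =>
    have hY : supp y ≤ (supportIso h Z).1 := (supportIso h Z).2.1
    rw [AlgHom.comp_apply, character_of]
    by_cases hs : supp s ≤ X
    · have hiff : supp (IntervalBand.mk h s hs) ≤ Z ↔ supp s ≤ (supportIso h Z).1 := by
        rw [← supp_le_supportIso, IntervalBand.val_mk, supp_mul_le, and_iff_right hY]
      rw [intervalRetraction_of_pos k h hs, character_of]
      by_cases hsZ : supp s ≤ (supportIso h Z).1
      · rw [if_pos hsZ, if_pos (hiff.2 hsZ)]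
      · rw [if_neg hsZ, if_neg (mt hiff.1 hsZ)]
    · rw [intervalRetraction_of_neg k h hs, map_zero,
        if_neg fun h1 => hs (h1.trans (supportIso h Z).2.2)]
  | add a b ha hb => rw [map_add, map_add, ha, hb]
  | smul c a ha => rw [map_smul, map_smul, ha]

/-- A skew derivation of `kS` for supports in `[supp y, X]` factors through `k(yS_{≤X})`. -/
theorem skewDerivation_intervalInclusion_intervalRetraction {Z W : SupportLattice S}
    (hZ : Z ∈ Set.Icc (supp y) X) (hW : W ∈ Set.Icc (supp y) X)
    (d : skewDerivation (character k Z) (character k W)) (a : MonoidAlgebra k S) :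
    skewLinearMap d (intervalInclusion k h (intervalRetraction k h a)) = skewLinearMap d a := by
  induction a using MonoidAlgebra.induction_on with
  | of s =>
    have hmul (s t : S) := skewLinearMap_mul d (MonoidAlgebra.of k S s) (MonoidAlgebra.of k S t)
    simp only [← map_mul, character_of] at hmul
    by_cases hs : supp s ≤ X
    · have hy := hmul y y
      rw [IsLeftRegularBand.mul_self, if_pos hW.1, if_pos hZ.1, one_mul, mul_one,
        right_eq_add] at hy
      rw [intervalRetraction_of_pos k h hs, intervalInclusion_of, IntervalBand.val_mk, hmul, hy,
        if_pos hW.1, one_mul, zero_mul, add_zero]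
    · have h1 := hmul s s
      rw [IsLeftRegularBand.mul_self, if_neg fun hn => hs (hn.trans hW.2),
        if_neg fun hn => hs (hn.trans hZ.2), zero_mul, mul_zero, add_zero] at h1
      rw [intervalRetraction_of_neg k h hs, map_zero, map_zero, h1]
  | add a b ha hb => simp only [map_add, ha, hb]
  | smul c a ha => simp only [map_smul, ha]

/-- `Ext¹(M_Z, M_W)` is the same over `k(yS_{≤X})` and over `kS`. -/
theorem nonempty_arrow_equiv (Z W : SupportLattice (IntervalBand y X h)) :
    Nonempty ((simpleVertex k Z ⟶ simpleVertex k W) ≃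
      (simpleVertex k (supportIso h Z).1 ⟶ simpleVertex k (supportIso h W).1)) := by
  obtain ⟨e₁⟩ := nonempty_ext_linearEquiv (hasCharacter_rep k Z) (hasCharacter_rep k W)
  have hZ := hasCharacter_rep k (supportIso h Z).1
  have hW := hasCharacter_rep k (supportIso h W).1
  rw [← character_comp_intervalRetraction] at hZ hW
  obtain ⟨e₂⟩ := nonempty_ext_linearEquiv hZ hW
  obtain ⟨e₃⟩ := nonempty_skewDerivation_linearEquiv (intervalRetraction k h)
    (intervalInclusion k h) (intervalRetraction_intervalInclusion k h)
    (χ := character k Z) (ψ := character k W) (by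
      rw [character_comp_intervalRetraction, character_comp_intervalRetraction]
      exact fun d hd => skewDerivation_intervalInclusion_intervalRetraction k h
        (supportIso h Z).2 (supportIso h W).2 ⟨d, hd⟩)
  -- Arrow sets index chosen bases, so a linear isomorphism of `Ext¹` spaces yields a bijection of
  -- arrows.
  exact ⟨((Module.Free.chooseBasis k _).map (e₁.symm.trans (e₃.trans e₂))).indexEquiv
    (Module.Free.chooseBasis k _)⟩

/-- The vertices of the quiver of `k(yS_{≤X})` are the vertices `M_Z` of the quiver of `kS` with
`Z` in `[supp y, X]`. -/
noncomputable def vertexEquiv [Finite S] :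
    ExtQuiver k (MonoidAlgebra k (IntervalBand y X h)) ≃
      FullSubquiver (simpleVertex (S := S) k '' Set.Icc (supp y) X) :=
  have : Finite (IntervalBand y X h) :=
    Finite.of_injective IntervalBand.val fun _ _ => IntervalBand.ext
  (Equiv.ofBijective _ (simpleVertex_bijective k)).symm.trans
    ((supportIso h).toEquiv.trans (Equiv.Set.image _ _ (simpleVertex_injective k)))

theorem vertexEquiv_simpleVertex [Finite S] (Z : SupportLattice (IntervalBand y X h)) :
    (vertexEquiv k h (simpleVertex k Z)).1 = simpleVertex k (supportIso h Z).1 := by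
  have : Finite (IntervalBand y X h) :=
    Finite.of_injective IntervalBand.val fun _ _ => IntervalBand.ext
  have h1 : (Equiv.ofBijective _ (simpleVertex_bijective k)).symm (simpleVertex k Z) = Z :=
    (Equiv.ofBijective _ (simpleVertex_bijective k)).symm_apply_apply Z
  exact congrArg (fun W => simpleVertex k (supportIso h W).1) h1

/-- The quiver of `k(yS_{≤X})` as a full subquiver of the quiver of `kS`. -/
noncomputable def quiverIso [Finite S] :
    QuiverIso (ExtQuiver k (MonoidAlgebra k (IntervalBand y X h)))
      (FullSubquiver (simpleVertex (S := S) k '' Set.Icc (supp y) X)) where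
  vertexEquiv := vertexEquiv k h
  arrowEquiv a b := Classical.choice (by
    have : Finite (IntervalBand y X h) :=
      Finite.of_injective IntervalBand.val fun _ _ => IntervalBand.ext
    obtain ⟨Z, rfl⟩ := (simpleVertex_bijective k).2 a
    obtain ⟨W, rfl⟩ := (simpleVertex_bijective k).2 b
    change Nonempty ((simpleVertex k Z ⟶ simpleVertex k W) ≃
      ((vertexEquiv k h (simpleVertex k Z)).1 ⟶ (vertexEquiv k h (simpleVertex k W)).1))
    rw [vertexEquiv_simpleVertex, vertexEquiv_simpleVertex]
    exact nonempty_arrow_equiv k h Z W)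

end Retraction

end LRB

theorem mainTheorem8 {S : Type v} [Monoid S] [IsLeftRegularBand S]
    (y : S) (X : LRB.SupportLattice S) :
    -- the degenerate case
    (¬ LRB.supp y ≤ X →
      IsEmpty (LRB.lowerCoset y X) ∧ Set.Icc (LRB.supp y) X = ∅ ∧
        LRB.arrowCount X (LRB.supp y) = 0) ∧
    -- the main case
    ∀ h : LRB.supp y ≤ X,
      -- the support lattice of `yS_{≤X}` is the interval `[supp y, X]`
      ∃ ι : LRB.SupportLattice (LRB.IntervalBand y X h) ≃o Set.Icc (LRB.supp y) X,
        (∀ t : LRB.IntervalBand y X h, (ι (LRB.supp t)).1 = LRB.supp t.val) ∧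
        -- `a_{XY}` computed in `S` is `a_{1̂0̂}` computed in `yS_{≤X}`
        (∃ one zero : LRB.SupportLattice (LRB.IntervalBand y X h), IsTop one ∧ IsBot zero ∧
          LRB.arrowCount X (LRB.supp y) = LRB.arrowCount one zero) ∧
        -- the quiver of `k(yS_{≤X})` is the full subquiver of the quiver of `kS` on the interval
        (∀ (k : Type u) [Field k] [Finite S],
          Function.Bijective
            (LRB.simpleVertex k : LRB.SupportLattice S → ExtQuiver k (MonoidAlgebra k S)) ∧
          ∃ Φ : QuiverIso (ExtQuiver k (MonoidAlgebra k (LRB.IntervalBand y X h)))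
              (FullSubquiver
                (LRB.simpleVertex (S := S) k '' Set.Icc (LRB.supp y) X)),
            ∀ Z : LRB.SupportLattice (LRB.IntervalBand y X h),
              (Φ.vertexEquiv (LRB.simpleVertex k Z)).1 = LRB.simpleVertex k (ι Z).1) := by
  refine ⟨fun h => ⟨LRB.isEmpty_lowerCoset h, Set.Icc_eq_empty h, if_neg h⟩, fun h =>
    ⟨LRB.supportIso h, LRB.supportIso_supp,
      ⟨LRB.topSupp h, LRB.supp 1, LRB.isTop_topSupp, LRB.isBot_supp_one,
        LRB.arrowCount_eq_arrowCount_intervalBand h⟩,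
      fun k _ _ => ⟨LRB.simpleVertex_bijective k, LRB.quiverIso k h,
        LRB.vertexEquiv_simpleVertex k h⟩⟩⟩
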